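/- There is a universal constant $c>0$ such that the following holds. Let $d,T\ge 1$ be integers, $R,G_2>0$, and let $\mathcal W\subseteq\{w\in\mathbb R^d:\|w\|_2\le R\}$ be nonempty, closed and convex. Put $r(w)=\tfrac12\|w\|_2^2$ and $\eta=\frac{R}{G_2\sqrt{dT}}$, and let $0<\delta_t\le R\sqrt{d/T}$ for $t=1,\dots,T$. Consider the two-point bandit algorithm: $\theta_1=0$, and for $t=1,\dots,T$, $$w_t=\arg\max_{w\in\mathcal W}\ \langle\theta_t,w\rangle-r(w),\qquad \tilde g_t=\frac{d}{2\delta_t}\bigl(f_t(w_t+\delta_tu_t)-f_t(w_t-\delta_tu_t)\bigr)u_t,\qquad \theta_{t+1}=\theta_t-\eta\,\tilde g_t,$$ where $u_t$ is uniformly distributed on the Euclidean unit sphere of $\mathbb R^d$ and independent of the past. The losses $f_t:\mathbb R^d\to\mathbb R$ are convex and $G_2$-Lipschitz with respect to $\|\cdot\|_2$, and are chosen by an adversary before $u_t$ is drawn. They may be fixed in advance or may depend on the past and on additional randomness: formally, there is a filtration $(\mathcal F_t)$ such that $f_t(w)$ is $\mathcal F_t$-measurable for each $w$, $u_t$ is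 independent of $\mathcal F_t$, and $u_t$ is $\mathcal F_{t+1}$-measurable. Then for every fixed $w^*\in\mathcal W$ the average regret against $w^*$ is integrable and $$\mathbb E\left[\frac1T\sum_{t=1}^T f_t(w_t)-\frac1T\sum_{t=1}^T f_t(w^*)\right]\ \le\ c\,G_2R\sqrt{\frac dT}.$$ -/

import Mathlib

open MeasureTheory ProbabilityTheory
open scoped NNReal ENNReal

noncomputable section

namespace TwoPointBandit

/-- Euclidean space `ℝ^d`. -/
abbrev Vec (d : ℕ) : Type := EuclideanSpace ℝ (Fin d)

/-- The Euclidean unit sphere of `ℝ^d`. -/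
abbrev UnitSphere (d : ℕ) : Type := Metric.sphere (0 : Vec d) 1

/-- The uniform distribution on the Euclidean unit sphere: the surface measure induced by
Lebesgue measure, normalized to total mass one. -/
def uniformSphere (d : ℕ) : Measure (UnitSphere d) :=
  ((volume : Measure (Vec d)).toSphere Set.univ)⁻¹ • (volume : Measure (Vec d)).toSphere

/-- A maximizer of `F` over `W` (an arbitrary vector if there is none). For `W` nonempty and
compact and `F` continuous and strictly concave it is the unique maximizer. -/
def argmaxOn {d : ℕ} (W : Set (Vec d)) (F : Vec d → ℝ) : Vec d :=
  Classical.epsilon fun w => w ∈ W ∧ IsMaxOn F W w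

/-- The mirror descent prediction `argmax_{w ∈ W} ⟨θ, w⟩ - r(w)`. -/
def predict {d : ℕ} (W : Set (Vec d)) (r : Vec d → ℝ) (θ : Vec d) : Vec d :=
  argmaxOn W fun w => inner ℝ θ w - r w

/-- The two-point gradient estimate `(d / (2δ)) (f(w + δu) - f(w - δu)) u`. -/
def gradEst {d : ℕ} (f : Vec d → ℝ) (δ : ℝ) (w u : Vec d) : Vec d :=
  ((d : ℝ) / (2 * δ) * (f (w + δ • u) - f (w - δ • u))) • u

/-- The dual state `θ` of the algorithm at the beginning of round `t` (rounds are numbered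
`0, 1, 2, …`), given the losses `f 0, f 1, …` and the sampled directions `u 0, u 1, …`. -/
def theta {d : ℕ} (W : Set (Vec d)) (r : Vec d → ℝ) (η : ℝ) (δ : ℕ → ℝ)
    (f : ℕ → Vec d → ℝ) (u : ℕ → UnitSphere d) : ℕ → Vec d
  | 0 => 0
  | t + 1 =>
      theta W r η δ f u t
        - η • gradEst (f t) (δ t) (predict W r (theta W r η δ f u t)) (u t)

/-- The point `w` predicted by the algorithm in round `t`. -/
def iterate {d : ℕ} (W : Set (Vec d)) (r : Vec d → ℝ) (η : ℝ) (δ : ℕ → ℝ)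
    (f : ℕ → Vec d → ℝ) (u : ℕ → UnitSphere d) (t : ℕ) : Vec d :=
  predict W r (theta W r η δ f u t)

/-- The average regret over `T` rounds against the fixed comparator `wstar`. -/
def avgRegret {d : ℕ} (T : ℕ) (f : ℕ → Vec d → ℝ) (w : ℕ → Vec d) (wstar : Vec d) : ℝ :=
  1 / (T : ℝ) * ∑ t ∈ Finset.range T, f t (w t)
    - 1 / (T : ℝ) * ∑ t ∈ Finset.range T, f t wstar

end TwoPointBandit

end

/-! The estimate `gradEst` enters the regret of mirror descent through two facts, each proved for
the law of the direction `u` with the loss held fixed.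

Second moment. A crude bound on its squared norm is of order `d ^ 2`; the rate needs order `d`. This
is concentration: for convex `K`-Lipschitz `f`, the mean square of `f u - f (-u)` on the sphere is
at most `8 K² / d` (`integral_sq_sub_neg_le`). The Poincaré inequality on the discrete cube gives
this for the vectors with coordinates `±1/√d` in any orthonormal basis
(`signVec_sum_sq_sub_neg_le`), and averaging over Haar-random rotations carries it to the sphere.

Bias. The identity "the mean of the estimate is the gradient of the smoothed loss" is replaced by
the one inequality needed against the comparator, `sub_le_integral_inner_gradEst`. It comes from
integrating by parts against a radial cutoff of the unit ball and letting the cutoff sharpen: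
convexity bounds the volume side from below, and the other side tends to the surface integral.

The potential argument `sum_inner_proj_sub_le` then bounds the linearized regret pathwise, and
integrating out each direction given the history yields the claim. -/

namespace TwoPointBandit

/-! ### Variance on the discrete cube and on sign vectors -/

/-- The Poincaré inequality on the discrete cube. -/
theorem cube_poincare (n : ℕ) (F : (Fin n → Bool) → ℝ) :
    (2 : ℝ) ^ n * ∑ e, F e ^ 2 - (∑ e, F e) ^ 2 ≤
      (2 : ℝ) ^ n / 4 * ∑ e, ∑ i, (F e - F (Function.update e i (!e i))) ^ 2 := by
  induction n with
  | zero => simp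
  | succ n ih =>
    have key : ∀ H : (Fin (n + 1) → Bool) → ℝ,
        ∑ e, H e = ∑ e, H (Fin.cons true e) + ∑ e, H (Fin.cons false e) := by
      intro H
      rw [← (Fin.consEquiv fun _ => Bool).sum_comp, Fintype.sum_prod_type]
      simp [Fin.consEquiv]
    have h0 := ih fun e => F (Fin.cons true e)
    have h1 := ih fun e => F (Fin.cons false e)
    -- Splitting on the first coordinate leaves, besides the two inductive variances, the squared
    -- difference of the half-cube sums. Cauchy–Schwarz bounds it by exactly the contribution of
    -- flipping that coordinate.
    have hcs : (∑ e, (F (Fin.cons true e) - F (Fin.cons false e))) ^ 2 ≤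
        (2 : ℝ) ^ n * ∑ e, (F (Fin.cons true e) - F (Fin.cons false e)) ^ 2 := by
      have := sq_sum_le_card_mul_sum_sq (s := (Finset.univ : Finset (Fin n → Bool)))
        (f := fun e => F (Fin.cons true e) - F (Fin.cons false e))
      simpa using this
    rw [key, key, key]
    simp only [Fin.sum_univ_succ, Fin.cons_zero, Fin.cons_succ, Fin.update_cons_zero,
      ← Fin.cons_update, Bool.not_true, Bool.not_false, Finset.sum_add_distrib] at *
    have hsymm : ∑ e : Fin n → Bool, (F (Fin.cons false e) - F (Fin.cons true e)) ^ 2 =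
        ∑ e, (F (Fin.cons true e) - F (Fin.cons false e)) ^ 2 :=
      Finset.sum_congr rfl fun _ _ => by ring
    rw [hsymm, pow_succ]
    rw [Finset.sum_sub_distrib] at hcs
    nlinarith [h0, h1, hcs]

section SignVectors

variable {E : Type*} [NormedAddCommGroup E] [InnerProductSpace ℝ E]

/-- A convex Lipschitz function has a bounded subgradient at every point. -/
theorem exists_subgradient [CompleteSpace E] {f : E → ℝ} {K : ℝ≥0}
    (hf : ConvexOn ℝ Set.univ f) (hl : LipschitzWith K f) (x : E) :
    ∃ g : E, ‖g‖ ≤ K ∧ ∀ y, f x + inner ℝ g (y - x) ≤ f y := by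
  have hopen : IsOpen {p : E × ℝ | p.1 ∈ Set.univ ∧ f p.1 < p.2} := by
    have := isOpen_lt (hl.continuous.comp continuous_fst) (continuous_snd (X := E) (Y := ℝ))
    simpa using this
  obtain ⟨l, hl'⟩ := geometric_hahn_banach_point_open (x := (x, f x)) hf.convex_strict_epigraph hopen
    (by simp)
  have hsplit : ∀ y : E, ∀ t : ℝ, l (y, t) = l (y, 0) + t * l (0, 1) := by
    intro y t
    have : (y, t) = (y, (0 : ℝ)) + t • ((0 : E), (1 : ℝ)) := by simp
    rw [this, map_add, map_smul, smul_eq_mul]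
  have ha : 0 < l (0, 1) := by
    have := hl' (x, f x + 1) (by simp)
    rw [hsplit, hsplit x (f x + 1)] at this
    linarith
  have hle : ∀ y, l (x, 0) + f x * l (0, 1) ≤ l (y, 0) + f y * l (0, 1) := by
    intro y
    refine le_of_forall_pos_le_add fun ε hε => ?_
    have := hl' (y, f y + ε / l (0, 1)) ⟨trivial, by simp only; linarith [div_pos hε ha]⟩
    rw [hsplit, hsplit y, add_mul, div_mul_cancel₀ _ ha.ne'] at this
    linarith
  set m : E →L[ℝ] ℝ := l.comp (ContinuousLinearMap.inl ℝ E ℝ) with hm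
  have hmv : ∀ v, l (v, 0) = m v := fun v => by simp [hm]
  set g : E := -(l (0, 1))⁻¹ • (InnerProductSpace.toDual ℝ E).symm m with hg
  have hgv : ∀ v, inner ℝ g v = -(l (0, 1))⁻¹ * m v := by
    intro v
    rw [hg, real_inner_smul_left, InnerProductSpace.toDual_symm_apply]
  have hsub : ∀ y, f x + inner ℝ g (y - x) ≤ f y := by
    intro y
    have := hle y
    rw [hmv, hmv] at this
    rw [hgv, map_sub]
    have h2 : (l (0, 1))⁻¹ * (m x - m y) ≤ f y - f x := by
      rw [inv_mul_le_iff₀ ha]; linarith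
    linarith
  refine ⟨g, ?_, hsub⟩
  by_contra! hlt
  have hgpos : 0 < ‖g‖ := lt_of_le_of_lt K.2 hlt
  -- Testing the subgradient in its own direction gives `‖g‖² ≤ K ‖g‖`.
  have h1 := hsub (x + g)
  have h2 := hl.dist_le_mul (x + g) x
  rw [add_sub_cancel_left, real_inner_self_eq_norm_sq] at h1
  rw [Real.dist_eq, dist_eq_norm, add_sub_cancel_left] at h2
  nlinarith [le_abs_self (f (x + g) - f x)]

/-- The vector with coordinates `±(1/√d)` in the family `b`. -/
noncomputable def signVec {d : ℕ} (b : Fin d → E) (e : Fin d → Bool) : E :=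
  (Real.sqrt d)⁻¹ • ∑ i, (if e i then (1 : ℝ) else -1) • b i

theorem signVec_sub_update {d : ℕ} (b : Fin d → E) (e : Fin d → Bool) (i : Fin d) :
    signVec b (Function.update e i (!e i)) - signVec b e =
      ((Real.sqrt d)⁻¹ * (if e i then (-2 : ℝ) else 2)) • b i := by
  rw [signVec, signVec, ← smul_sub, ← Finset.sum_sub_distrib, mul_smul]
  congr 1
  rw [Finset.sum_eq_single i]
  · rw [← sub_smul]
    congr 1
    cases h : e i <;> simp <;> norm_num
  · intro j _ hj
    simp [Function.update_of_ne hj]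
  · simp

theorem signVec_not {d : ℕ} (b : Fin d → E) (e : Fin d → Bool) :
    signVec b (fun i => !e i) = -signVec b e := by
  rw [signVec, signVec, ← smul_neg, ← Finset.sum_neg_distrib]
  congr 1
  refine Finset.sum_congr rfl fun i _ => ?_
  rw [← neg_smul]
  congr 1
  cases e i <;> simp

theorem norm_signVec {d : ℕ} (hd : 0 < d) {b : Fin d → E} (hb : Orthonormal ℝ b)
    (e : Fin d → Bool) : ‖signVec b e‖ = 1 := by
  have hd' : (0 : ℝ) < d := by exact_mod_cast hd
  have h : ‖∑ i, (if e i then (1 : ℝ) else -1) • b i‖ ^ 2 = d := by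
    rw [← real_inner_self_eq_norm_sq, hb.inner_sum]
    have : ∀ i, (starRingEnd ℝ) (if e i then (1 : ℝ) else -1) * (if e i then (1 : ℝ) else -1) = 1 := by
      intro i; cases e i <;> simp
    rw [Finset.sum_congr rfl fun i _ => this i]
    simp
  rw [signVec, norm_smul, norm_inv, Real.norm_of_nonneg (Real.sqrt_nonneg _),
    ← Real.sqrt_sq (norm_nonneg (∑ i, _)), h, inv_mul_cancel₀ (Real.sqrt_pos.2 hd').ne']

theorem map_signVec {F : Type*} [NormedAddCommGroup F] [InnerProductSpace ℝ F] {d : ℕ}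
    (L : E ≃ₗᵢ[ℝ] F) (b : Fin d → E) (e : Fin d → Bool) :
    L (signVec b e) = signVec (fun i => L (b i)) e := by
  simp only [signVec, map_smul, map_sum]

/-- The variance of a convex Lipschitz function over the sign vectors of an orthonormal family. -/
theorem signVec_variance_le [CompleteSpace E] {d : ℕ} (hd : 0 < d) {b : Fin d → E}
    (hb : Orthonormal ℝ b) {f : E → ℝ} {K : ℝ≥0}
    (hf : ConvexOn ℝ Set.univ f) (hl : LipschitzWith K f) :
    (2 : ℝ) ^ d * ∑ e, f (signVec b e) ^ 2 - (∑ e, f (signVec b e)) ^ 2 ≤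
      ((2 : ℝ) ^ d) ^ 2 * (2 * K ^ 2 / d) := by
  have hd' : (0 : ℝ) < d := by exact_mod_cast hd
  set F : (Fin d → Bool) → ℝ := fun e => f (signVec b e) with hF
  choose g hgK hg using fun e => exists_subgradient hf hl (signVec b e)
  set fl : Fin d → (Fin d → Bool) → (Fin d → Bool) := fun i e => Function.update e i (!e i) with hfl
  have hinv : ∀ i, Function.Involutive (fl i) := by
    intro i e
    simp [hfl]
  have hpos : ∀ e i, F e - F (fl i e) ≤ 2 * (Real.sqrt d)⁻¹ * |inner ℝ (b i) (g e)| := by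
    intro e i
    have h := hg e (signVec b (fl i e))
    rw [hfl, signVec_sub_update, real_inner_smul_right, real_inner_comm] at h
    have h2 : |(Real.sqrt d)⁻¹ * (if e i then (-2 : ℝ) else 2) * inner ℝ (b i) (g e)| =
        2 * (Real.sqrt d)⁻¹ * |inner ℝ (b i) (g e)| := by
      rw [abs_mul, abs_mul, abs_of_nonneg (inv_nonneg.2 (Real.sqrt_nonneg _)),
        mul_comm 2]
      congr 2
      cases e i <;> simp
    have h3 := neg_abs_le ((Real.sqrt d)⁻¹ * (if e i then (-2 : ℝ) else 2) * inner ℝ (b i) (g e))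
    simp only [hF, hfl] at *
    linarith
  -- The subgradient at the endpoint with the larger value controls the difference; taking both
  -- endpoints covers either case. The Lipschitz bound alone would give `4 K² / d` for each of the
  -- `d` coordinates and lose the factor `1 / d`; with subgradients, Bessel's inequality sums the
  -- coordinates to `K²`.
  have hsq : ∀ e i, (F e - F (fl i e)) ^ 2 ≤
      4 / d * (inner ℝ (b i) (g e) ^ 2 + inner ℝ (b i) (g (fl i e)) ^ 2) := by
    intro e i
    have h1 := hpos e i
    have h2 := hpos (fl i e) i
    rw [hinv i e] at h2
    have hs : (Real.sqrt d)⁻¹ ^ 2 = 1 / d := by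
      rw [inv_pow, Real.sq_sqrt hd'.le, one_div]
    have e1 : (2 * (Real.sqrt d)⁻¹ * |inner ℝ (b i) (g e)|) ^ 2 = 4 / d * inner ℝ (b i) (g e) ^ 2 := by
      rw [mul_pow, mul_pow, hs, sq_abs]; ring
    have e2 : (2 * (Real.sqrt d)⁻¹ * |inner ℝ (b i) (g (fl i e))|) ^ 2 =
        4 / d * inner ℝ (b i) (g (fl i e)) ^ 2 := by
      rw [mul_pow, mul_pow, hs, sq_abs]; ring
    rw [mul_add, ← e1, ← e2]
    rcases le_total (F (fl i e)) (F e) with h | h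
    · nlinarith [sq_nonneg (2 * (Real.sqrt d)⁻¹ * |inner ℝ (b i) (g (fl i e))|)]
    · nlinarith [sq_nonneg (2 * (Real.sqrt d)⁻¹ * |inner ℝ (b i) (g e)|)]
  have hbessel : ∀ e, ∑ i, inner ℝ (b i) (g e) ^ 2 ≤ (K : ℝ) ^ 2 := by
    intro e
    have h := hb.sum_inner_products_le (g e) (s := Finset.univ)
    simp only [Real.norm_eq_abs, sq_abs] at h
    exact h.trans (pow_le_pow_left₀ (norm_nonneg _) (hgK e) 2)
  have hsum : ∑ e, ∑ i, (F e - F (fl i e)) ^ 2 ≤ (2 : ℝ) ^ d * (8 * K ^ 2 / d) := by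
    calc ∑ e, ∑ i, (F e - F (fl i e)) ^ 2
        ≤ ∑ e, ∑ i, 4 / d * (inner ℝ (b i) (g e) ^ 2 + inner ℝ (b i) (g (fl i e)) ^ 2) :=
          Finset.sum_le_sum fun e _ => Finset.sum_le_sum fun i _ => hsq e i
      _ = ∑ e, 8 / d * ∑ i, inner ℝ (b i) (g e) ^ 2 := by
          simp only [mul_add, Finset.sum_add_distrib]
          have : ∑ e, ∑ i, 4 / (d : ℝ) * inner ℝ (b i) (g (fl i e)) ^ 2 =
              ∑ e, ∑ i, 4 / (d : ℝ) * inner ℝ (b i) (g e) ^ 2 := by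
            refine Finset.sum_comm.trans ((Finset.sum_congr rfl fun i _ => ?_).trans Finset.sum_comm)
            exact Equiv.sum_comp (hinv i).toPerm fun e => 4 / (d : ℝ) * inner ℝ (b i) (g e) ^ 2
          rw [this, ← Finset.sum_add_distrib]
          refine Finset.sum_congr rfl fun e _ => ?_
          rw [← Finset.mul_sum]; ring
      _ ≤ ∑ _e : Fin d → Bool, 8 / d * (K : ℝ) ^ 2 :=
          Finset.sum_le_sum fun e _ => mul_le_mul_of_nonneg_left (hbessel e) (by positivity)
      _ = (2 : ℝ) ^ d * (8 * K ^ 2 / d) := by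
          simp; ring
  refine (cube_poincare d F).trans ?_
  calc (2 : ℝ) ^ d / 4 * ∑ e, ∑ i, (F e - F (fl i e)) ^ 2
      ≤ (2 : ℝ) ^ d / 4 * ((2 : ℝ) ^ d * (8 * K ^ 2 / d)) :=
        mul_le_mul_of_nonneg_left hsum (by positivity)
    _ = _ := by ring

/-- Both values are compared with the mean `m`. Negation permutes the sign vectors, so the two
deviations have equal sums of squares, and the total is at most four times the variance sum. -/
theorem signVec_sum_sq_sub_neg_le [CompleteSpace E] {d : ℕ} (hd : 0 < d) {b : Fin d → E}
    (hb : Orthonormal ℝ b) {f : E → ℝ} {K : ℝ≥0}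
    (hf : ConvexOn ℝ Set.univ f) (hl : LipschitzWith K f) :
    ∑ e, (f (signVec b e) - f (-signVec b e)) ^ 2 ≤ (2 : ℝ) ^ d * (8 * K ^ 2 / d) := by
  have h := signVec_variance_le hd hb hf hl
  set N : ℝ := 2 ^ d with hN
  have hNpos : 0 < N := by positivity
  set m : ℝ := (∑ e, f (signVec b e)) / N with hm
  have hm' : ∑ e, f (signVec b e) = N * m := by rw [hm]; field_simp
  have hcard : ∑ _e : Fin d → Bool, m ^ 2 = N * m ^ 2 := by simp [hN]
  have hvar : N * ∑ e, (f (signVec b e) - m) ^ 2 =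
      N * ∑ e, f (signVec b e) ^ 2 - (∑ e, f (signVec b e)) ^ 2 := by
    simp only [sub_sq, Finset.sum_add_distrib, Finset.sum_sub_distrib, hcard, ← Finset.sum_mul,
      ← Finset.mul_sum, hm']
    ring
  have hflip : ∑ e, (f (-signVec b e) - m) ^ 2 = ∑ e, (f (signVec b e) - m) ^ 2 := by
    have hi : Function.Involutive fun (e : Fin d → Bool) i => !e i := fun e => by simp
    rw [← Equiv.sum_comp hi.toPerm]
    refine Finset.sum_congr rfl fun e _ => ?_
    simp [Function.Involutive.toPerm, signVec_not]
  have hle : ∑ e, (f (signVec b e) - f (-signVec b e)) ^ 2 ≤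
      4 * ∑ e, (f (signVec b e) - m) ^ 2 := by
    calc ∑ e, (f (signVec b e) - f (-signVec b e)) ^ 2
        ≤ ∑ e, (2 * (f (signVec b e) - m) ^ 2 + 2 * (f (-signVec b e) - m) ^ 2) :=
          Finset.sum_le_sum fun e _ => by
            nlinarith [sq_nonneg (f (signVec b e) - m + (f (-signVec b e) - m))]
      _ = _ := by
          rw [Finset.sum_add_distrib, ← Finset.mul_sum, ← Finset.mul_sum, hflip]; ring
  rw [← hvar] at h
  have : ∑ e, (f (signVec b e) - m) ^ 2 ≤ N * (2 * K ^ 2 / d) := by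
    refine le_of_mul_le_mul_left ?_ hNpos
    calc _ ≤ _ := h
      _ = _ := by ring
  calc _ ≤ _ := hle
    _ ≤ 4 * (N * (2 * K ^ 2 / d)) := by linarith
    _ = _ := by ring

end SignVectors

/-! ### Polar coordinates -/

section Polar

variable {E : Type*} [NormedAddCommGroup E] [NormedSpace ℝ E] [FiniteDimensional ℝ E]
  [Nontrivial E] [MeasurableSpace E] [BorelSpace E] (μ : Measure E) [μ.IsAddHaarMeasure]

/-- Integration in polar coordinates. -/
theorem integral_polar (F : E → ℝ) :
    ∫ x, F x ∂μ = ∫ p : Metric.sphere (0 : E) 1 × Set.Ioi (0 : ℝ), F (p.2.1 • p.1.1)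
      ∂(μ.toSphere.prod (Measure.volumeIoiPow (Module.finrank ℝ E - 1))) := by
  rw [← μ.measurePreserving_homeomorphUnitSphereProd.integral_comp
    (Homeomorph.measurableEmbedding _)]
  have : ∀ x : ({0}ᶜ : Set E), F ((homeomorphUnitSphereProd E x).2.1 •
      (homeomorphUnitSphereProd E x).1.1) = F x := by
    intro x
    rw [← homeomorphUnitSphereProd_symm_apply_coe, Homeomorph.symm_apply_apply]
  simp only [this]
  rw [integral_subtype_comap (measurableSet_singleton _).compl F,
    restrict_compl_singleton]

theorem volumeIoiPow_real_Iio (n : ℕ) (x : Set.Ioi (0 : ℝ)) :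
    (Measure.volumeIoiPow n).real (Set.Iio x) = x.1 ^ (n + 1) / (n + 1) := by
  have : (0 : ℝ) < x.1 := x.2
  rw [measureReal_def, Measure.volumeIoiPow_apply_Iio, ENNReal.toReal_ofReal (by positivity)]

/-- The surface integral as an integral over the unit ball. -/
theorem integral_toSphere (ψ : E → ℝ) :
    ∫ u, ψ u.1 ∂μ.toSphere =
      Module.finrank ℝ E * ∫ x in Metric.ball 0 1, ψ (‖x‖⁻¹ • x) ∂μ := by
  rw [← integral_indicator measurableSet_ball,
    integral_polar μ ((Metric.ball (0 : E) 1).indicator _)]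
  have hpos : 0 < Module.finrank ℝ E := Module.finrank_pos
  -- The radial extension over the ball is a product in polar coordinates, and the radial factor
  -- `(0, 1)` has mass `1 / finrank`.
  have : ∀ p : Metric.sphere (0 : E) 1 × Set.Ioi (0 : ℝ),
      (Metric.ball (0 : E) 1).indicator (fun x => ψ (‖x‖⁻¹ • x)) (p.2.1 • p.1.1) =
        ψ p.1.1 * (Set.Iio (⟨1, Set.mem_Ioi.2 one_pos⟩ : Set.Ioi (0 : ℝ))).indicator 1 p.2 := by
    rintro ⟨⟨v, hv⟩, ⟨r, hr⟩⟩
    have hr' : (0 : ℝ) < r := hr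
    have hv' : ‖v‖ = 1 := by simpa using hv
    have hn : ‖r • v‖ = r := by rw [norm_smul, hv', mul_one, Real.norm_of_nonneg hr'.le]
    by_cases h : r < 1
    · rw [Set.indicator_of_mem (by simpa [hn] using h), Set.indicator_of_mem (by simpa using h),
        hn, smul_smul, inv_mul_cancel₀ hr'.ne']
      simp
    · rw [Set.indicator_of_notMem (by simpa [hn] using h),
        Set.indicator_of_notMem (by simpa using h), mul_zero]
  simp only [this]
  rw [integral_prod_mul (fun u : Metric.sphere (0 : E) 1 => ψ u.1), integral_indicator_one
    measurableSet_Iio, volumeIoiPow_real_Iio, Nat.cast_pred hpos]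
  have : (Module.finrank ℝ E : ℝ) ≠ 0 := by exact_mod_cast hpos.ne'
  simp
  field_simp

end Polar

/-! ### The uniform law on the sphere and averaging over rotations -/

section UniformSphere

variable {d : ℕ}

theorem nontrivial_vec (hd : 0 < d) : Nontrivial (Vec d) :=
  Module.nontrivial_of_finrank_pos (R := ℝ) (by simpa using hd)

theorem isProbabilityMeasure_uniformSphere (hd : 0 < d) :
    IsProbabilityMeasure (uniformSphere d) := by
  have := nontrivial_vec hd
  refine ⟨?_⟩
  rw [uniformSphere, Measure.smul_apply, smul_eq_mul]
  exact ENNReal.inv_mul_cancel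
    (by simp [hd.ne', (Metric.measure_ball_pos volume (0 : Vec d) one_pos).ne']) (measure_ne_top _ _)

theorem integral_uniformSphere (g : UnitSphere d → ℝ) :
    ∫ u, g u ∂uniformSphere d =
      (d * (volume : Measure (Vec d)).real (Metric.ball 0 1))⁻¹ *
        ∫ u, g u ∂(volume : Measure (Vec d)).toSphere := by
  rw [uniformSphere, integral_smul_measure, ENNReal.toReal_inv, ← measureReal_def,
    Measure.toSphere_real_apply_univ, finrank_euclideanSpace_fin, smul_eq_mul]

/-- Written as integrals over the ball, both sides agree because a linear isometry preserves
Lebesgue measure, the ball and the norm. -/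
theorem integral_uniformSphere_comp_isometry (hd : 0 < d) (L : Vec d ≃ₗᵢ[ℝ] Vec d)
    (ψ : Vec d → ℝ) :
    ∫ u, ψ (L u.1) ∂uniformSphere d = ∫ u, ψ u.1 ∂uniformSphere d := by
  have := nontrivial_vec hd
  rw [integral_uniformSphere, integral_uniformSphere, integral_toSphere volume fun x => ψ (L x),
    integral_toSphere]
  have hpre : L ⁻¹' Metric.ball 0 1 = Metric.ball 0 1 := by
    ext x; simp
  have h := L.measurePreserving.setIntegral_preimage_emb L.toHomeomorph.measurableEmbedding
    (fun x => ψ (‖x‖⁻¹ • x)) (Metric.ball 0 1)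
  rw [hpre] at h
  rw [← h]
  simp

/-- The group of linear isometries of `ℝ^d`. -/
abbrev Rot (d : ℕ) : Type := unitary (Vec d →L[ℝ] Vec d)

instance : ContinuousStar (Vec d →L[ℝ] Vec d) :=
  ⟨(ContinuousLinearMap.adjoint (𝕜 := ℝ) (E := Vec d) (F := Vec d)).continuous⟩

instance : CompactSpace (Rot d) := by
  have : ProperSpace (Vec d →L[ℝ] Vec d) := FiniteDimensional.proper_real _
  refine isCompact_iff_compactSpace.1 (Metric.isCompact_of_isClosed_isBounded isClosed_unitary ?_)
  refine (Metric.isBounded_closedBall (x := (0 : Vec d →L[ℝ] Vec d)) (r := 1)).subset ?_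
  intro Q hQ
  rw [mem_closedBall_zero_iff]
  refine ContinuousLinearMap.opNorm_le_bound _ zero_le_one fun x => ?_
  rw [one_mul]
  exact ((Unitary.linearIsometryEquiv ⟨Q, hQ⟩).norm_map x).le

noncomputable instance : MeasurableSpace (Rot d) := borel _

instance : BorelSpace (Rot d) := ⟨rfl⟩

theorem exists_rot_apply_eq {v w : Vec d} (h : ‖v‖ = ‖w‖) : ∃ Q : Rot d, Q.1 v = w :=
  ⟨Unitary.linearIsometryEquiv.symm (Submodule.reflection (ℝ ∙ (v - w))ᗮ),
    Submodule.reflection_sub h⟩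

/-- An integral over the sphere is at most the largest average over a rotated finite family. -/
theorem integral_uniformSphere_le_of_rotations (hd : 0 < d) {ι : Type*} [Fintype ι] [Nonempty ι]
    (v : ι → Vec d) (hv : ∀ j, ‖v j‖ = 1) {ψ : Vec d → ℝ} (hψ : Continuous ψ) {C : ℝ}
    (h : ∀ L : Vec d ≃ₗᵢ[ℝ] Vec d, ∑ j, ψ (L (v j)) ≤ Fintype.card ι * C) :
    ∫ u, ψ u.1 ∂uniformSphere d ≤ C := by
  have := isProbabilityMeasure_uniformSphere hd
  set μ : Measure (Rot d) := Measure.haarMeasure ⊤ with hμ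
  have : IsProbabilityMeasure μ := ⟨by
    have := Measure.haarMeasure_self (K₀ := (⊤ : TopologicalSpace.PositiveCompacts (Rot d)))
    simpa using this⟩
  have hcont : Continuous fun p : Rot d × Vec d => ψ ((p.1⁻¹).1 p.2) := by
    refine hψ.comp ?_
    exact (continuous_subtype_val.comp (continuous_fst.inv)).clm_apply continuous_snd
  have hint : ∀ w : Vec d, Integrable (fun Q : Rot d => ψ ((Q⁻¹).1 w)) μ := fun w =>
    (hcont.comp (Continuous.prodMk_left w)).integrable_of_hasCompactSupport
      (HasCompactSupport.of_compactSpace _)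
  -- `Φ` depends only on the norm, by left invariance of Haar measure and transitivity of rotations
  -- on spheres; the inverse is there so that left translation cancels. Hence `Φ` on unit vectors is
  -- the spherical mean of `ψ`, whatever finite family is rotated.
  set Φ : Vec d → ℝ := fun w => ∫ Q : Rot d, ψ ((Q⁻¹).1 w) ∂μ with hΦ
  have hconst : ∀ w w' : Vec d, ‖w‖ = ‖w'‖ → Φ w' = Φ w := by
    intro w w' hww
    obtain ⟨Q', rfl⟩ := exists_rot_apply_eq hww
    calc Φ (Q'.1 w) = ∫ Q : Rot d, ψ (((Q' * Q)⁻¹).1 (Q'.1 w)) ∂μ :=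
          (integral_mul_left_eq_self (fun Q : Rot d => ψ ((Q⁻¹).1 (Q'.1 w))) Q').symm
      _ = Φ w := by
          refine integral_congr_ae (Filter.Eventually.of_forall fun Q => ?_)
          have : (Q' * Q)⁻¹ * Q' = Q⁻¹ := by group
          have h2 : ((Q' * Q)⁻¹).1 (Q'.1 w) = (((Q' * Q)⁻¹ * Q').1) w := rfl
          simp only [h2, this]
  have hswap : ∫ u : UnitSphere d, Φ u.1 ∂uniformSphere d = ∫ u, ψ u.1 ∂uniformSphere d := by
    have hc : Continuous fun p : UnitSphere d × Rot d => ψ ((p.2⁻¹).1 p.1.1) := by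
      have hu : Continuous fun p : UnitSphere d × Rot d => (p.1 : Vec d) :=
        continuous_subtype_val.comp continuous_fst
      refine hψ.comp ?_
      exact (continuous_subtype_val.comp
        (continuous_snd (X := UnitSphere d) (Y := Rot d)).inv).clm_apply hu
    have hswap' : ∫ u : UnitSphere d, ∫ Q : Rot d, ψ ((Q⁻¹).1 u.1) ∂μ ∂uniformSphere d =
        ∫ Q : Rot d, ∫ u : UnitSphere d, ψ ((Q⁻¹).1 u.1) ∂uniformSphere d ∂μ :=
      integral_integral_swap_of_hasCompactSupport hc (HasCompactSupport.of_compactSpace _)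
    refine hswap'.trans ?_
    have h2 : ∀ Q : Rot d, ∫ u : UnitSphere d, ψ ((Q⁻¹).1 u.1) ∂uniformSphere d =
        ∫ u, ψ u.1 ∂uniformSphere d := fun Q =>
      integral_uniformSphere_comp_isometry hd (Unitary.linearIsometryEquiv Q⁻¹) ψ
    simp [h2]
  obtain ⟨j₀⟩ := ‹Nonempty ι›
  have hΦv : ∀ j, Φ (v j) = ∫ u, ψ u.1 ∂uniformSphere d := by
    intro j
    rw [← hswap, integral_congr_ae (g := fun _ => Φ (v j))]
    · simp
    · exact Filter.Eventually.of_forall fun u => hconst _ _ (by rw [hv, norm_eq_of_mem_sphere])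
  have hsum : ∑ j, Φ (v j) ≤ Fintype.card ι * C := by
    rw [hΦ, ← integral_finsetSum _ fun j _ => hint (v j)]
    calc _ ≤ ∫ _ : Rot d, Fintype.card ι * C ∂μ :=
          integral_mono (integrable_finsetSum _ fun j _ => hint (v j)) (integrable_const _)
            fun Q => h (Unitary.linearIsometryEquiv Q⁻¹)
      _ = _ := by simp
  simp only [hΦv, Finset.sum_const, Finset.card_univ, nsmul_eq_mul] at hsum
  exact le_of_mul_le_mul_left hsum (by exact_mod_cast Fintype.card_pos_iff.2 ⟨j₀⟩)

/-- The odd part of a convex Lipschitz function concentrates on the sphere. -/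
theorem integral_sq_sub_neg_le (hd : 0 < d) {f : Vec d → ℝ} {K : ℝ≥0}
    (hf : ConvexOn ℝ Set.univ f) (hl : LipschitzWith K f) :
    ∫ u, (f u.1 - f (-u.1)) ^ 2 ∂uniformSphere d ≤ 8 * K ^ 2 / d := by
  set b := (EuclideanSpace.basisFun (Fin d) ℝ) with hb
  refine integral_uniformSphere_le_of_rotations hd (signVec b)
    (norm_signVec hd b.orthonormal) (ψ := fun u => (f u - f (-u)) ^ 2)
    ((hl.continuous.sub (hl.continuous.comp continuous_neg)).pow 2) fun L => ?_
  have := signVec_sum_sq_sub_neg_le hd (b.orthonormal.comp_linearIsometryEquiv L) hf hl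
  simpa [map_signVec, Function.comp_def] using this

end UniformSphere

/-! ### Integration by parts with a radial cutoff -/

section Cutoff

variable {E : Type*} [NormedAddCommGroup E]

/-- The radial cutoff that is `1` on the unit ball, `0` outside the ball of radius `1 + ε`, and
affine in the norm in between. -/
noncomputable def cutoff (ε : ℝ) (x : E) : ℝ := max 0 (min 1 (ε⁻¹ * (1 + ε - ‖x‖)))

theorem cutoff_nonneg (ε : ℝ) (x : E) : 0 ≤ cutoff ε x := le_max_left _ _

theorem cutoff_eq_one {ε : ℝ} (hε : 0 < ε) {x : E} (hx : ‖x‖ ≤ 1) : cutoff ε x = 1 := by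
  have : 1 ≤ ε⁻¹ * (1 + ε - ‖x‖) := by
    rw [le_inv_mul_iff₀ hε]
    linarith
  rw [cutoff, min_eq_left this, max_eq_right zero_le_one]

theorem cutoff_eq_zero {ε : ℝ} (hε : 0 < ε) {x : E} (hx : 1 + ε ≤ ‖x‖) : cutoff ε x = 0 := by
  have : ε⁻¹ * (1 + ε - ‖x‖) ≤ 0 :=
    mul_nonpos_of_nonneg_of_nonpos (inv_nonneg.2 hε.le) (by linarith)
  exact max_eq_left ((min_le_right _ _).trans this)

theorem cutoff_eq_of_mem_shell {ε : ℝ} (hε : 0 < ε) {x : E} (h1 : 1 ≤ ‖x‖) (h2 : ‖x‖ ≤ 1 + ε) :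
    cutoff ε x = ε⁻¹ * (1 + ε - ‖x‖) := by
  have h0 : 0 ≤ ε⁻¹ * (1 + ε - ‖x‖) := mul_nonneg (inv_nonneg.2 hε.le) (by linarith)
  have h3 : ε⁻¹ * (1 + ε - ‖x‖) ≤ 1 := by
    rw [inv_mul_le_iff₀ hε]
    linarith
  rw [cutoff, min_eq_right h3, max_eq_right h0]

theorem lipschitzWith_cutoff {ε : ℝ} (hε : 0 < ε) :
    LipschitzWith ⟨ε⁻¹, inv_nonneg.2 hε.le⟩ (cutoff ε : E → ℝ) := by
  refine LipschitzWith.const_max (LipschitzWith.const_min (LipschitzWith.of_dist_le_mul ?_) 1) 0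
  intro x y
  rw [Real.dist_eq, dist_eq_norm, ← mul_sub, abs_mul, abs_of_pos (inv_pos.2 hε),
    sub_sub_sub_cancel_left, abs_sub_comm]
  exact mul_le_mul_of_nonneg_left (abs_norm_sub_norm_le x y) (inv_nonneg.2 hε.le)

variable [InnerProductSpace ℝ E]

theorem hasCompactSupport_cutoff [FiniteDimensional ℝ E] {ε : ℝ} (hε : 0 < ε) :
    HasCompactSupport (cutoff ε : E → ℝ) := by
  refine HasCompactSupport.intro (isCompact_closedBall (0 : E) (1 + ε)) fun x hx => ?_
  exact cutoff_eq_zero hε (by simpa using (not_le.1 (mt mem_closedBall_zero_iff.2 hx)).le)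

theorem hasLineDerivAt_norm {x : E} (hx : x ≠ 0) (v : E) :
    HasLineDerivAt ℝ (fun y : E => ‖y‖) (inner ℝ x v / ‖x‖) x v := by
  have h1 : HasDerivAt (fun t : ℝ => x + t • v) v 0 := by
    simpa using ((hasDerivAt_id (0 : ℝ)).smul_const v).const_add x
  have h2 := h1.norm_sq.sqrt (by simpa using hx)
  simp only [zero_smul, add_zero, Real.sqrt_sq (norm_nonneg _)] at h2
  rwa [mul_div_mul_left _ _ two_ne_zero] at h2

theorem lineDeriv_cutoff_shell {ε : ℝ} (hε : 0 < ε) {x : E} (h1 : 1 < ‖x‖) (h2 : ‖x‖ < 1 + ε)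
    (v : E) : lineDeriv ℝ (cutoff ε) x (-v) = ε⁻¹ * (inner ℝ x v / ‖x‖) := by
  have hx : x ≠ 0 := by
    rintro rfl
    simp at h1
    linarith
  have hev : cutoff ε =ᶠ[nhds x] fun y : E => ε⁻¹ * (1 + ε - ‖y‖) := by
    have hopen : IsOpen {y : E | 1 < ‖y‖ ∧ ‖y‖ < 1 + ε} :=
      (isOpen_lt continuous_const continuous_norm).inter (isOpen_lt continuous_norm continuous_const)
    filter_upwards [hopen.mem_nhds ⟨h1, h2⟩] with y hy
    exact cutoff_eq_of_mem_shell hε hy.1.le hy.2.le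
  rw [hev.lineDeriv_eq]
  refine HasLineDerivAt.lineDeriv ?_
  have h := (HasDerivAt.const_sub (1 + ε) (hasLineDerivAt_norm hx (-v))).const_mul ε⁻¹
  rw [inner_neg_right, neg_div, neg_neg] at h
  exact h

theorem lineDeriv_cutoff_of_norm_lt {ε : ℝ} (hε : 0 < ε) {x : E} (h : ‖x‖ < 1) (v : E) :
    lineDeriv ℝ (cutoff ε) x v = 0 := by
  have hev : cutoff ε =ᶠ[nhds x] fun _ : E => 1 := by
    filter_upwards [(isOpen_lt continuous_norm continuous_const).mem_nhds h] with y hy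
    exact cutoff_eq_one hε (le_of_lt hy)
  rw [hev.lineDeriv_eq]
  simp [lineDeriv]

theorem lineDeriv_cutoff_of_lt_norm {ε : ℝ} (hε : 0 < ε) {x : E} (h : 1 + ε < ‖x‖) (v : E) :
    lineDeriv ℝ (cutoff ε) x v = 0 := by
  have hev : cutoff ε =ᶠ[nhds x] fun _ : E => 0 := by
    filter_upwards [(isOpen_lt continuous_const continuous_norm).mem_nhds h] with y hy
    exact cutoff_eq_zero hε (le_of_lt hy)
  rw [hev.lineDeriv_eq]
  simp [lineDeriv]

/-- The directional derivative of a convex function dominates backward differences. -/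
theorem sub_le_lineDeriv {f : E → ℝ} (hf : ConvexOn ℝ Set.univ f) {x v : E}
    (hx : LineDifferentiableAt ℝ f x v) : f x - f (x - v) ≤ lineDeriv ℝ f x v := by
  have hconv : ConvexOn ℝ Set.univ fun t : ℝ => f (x + t • v) := by
    have := hf.comp_affineMap (AffineMap.lineMap x (x + v))
    rw [Set.preimage_univ] at this
    refine this.congr fun t _ => ?_
    simp [AffineMap.lineMap_apply, add_comm]
  have h := hconv.slope_le_of_hasDerivAt (Set.mem_univ (-1)) (Set.mem_univ 0) (by norm_num)
    hx.hasLineDerivAt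
  simpa [slope_def_field, ← sub_eq_add_neg] using h

variable [FiniteDimensional ℝ E] [MeasurableSpace E] [BorelSpace E]
  (μ : Measure E) [μ.IsAddHaarMeasure]

theorem integrable_cutoff {ε : ℝ} (hε : 0 < ε) : Integrable (cutoff ε) μ :=
  (lipschitzWith_cutoff hε).continuous.integrable_of_hasCompactSupport
    (hasCompactSupport_cutoff hε)

theorem measureReal_ball_le_integral_cutoff {ε : ℝ} (hε : 0 < ε) :
    μ.real (Metric.ball 0 1) ≤ ∫ x, cutoff ε x ∂μ := by
  rw [← integral_indicator_one measurableSet_ball]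
  refine integral_mono ((integrable_indicator_iff measurableSet_ball).2
    (integrableOn_const measure_ball_lt_top.ne)) (integrable_cutoff μ hε) fun x => ?_
  by_cases hx : x ∈ Metric.ball (0 : E) 1
  · rw [Set.indicator_of_mem hx, cutoff_eq_one hε (mem_ball_zero_iff.1 hx).le, Pi.one_apply]
  · rw [Set.indicator_of_notMem hx]
    exact cutoff_nonneg _ _

theorem integral_cutoff_le {ε : ℝ} (hε : 0 < ε) :
    ∫ x, cutoff ε x ∂μ ≤ (1 + ε) ^ Module.finrank ℝ E * μ.real (Metric.ball 0 1) := by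
  have hball : μ.real (Metric.ball 0 (1 + ε)) =
      (1 + ε) ^ Module.finrank ℝ E * μ.real (Metric.ball 0 1) := by
    rw [measureReal_def, Measure.addHaar_ball_of_pos μ _ (by linarith), ENNReal.toReal_mul,
      ENNReal.toReal_ofReal (by positivity), measureReal_def]
  rw [← hball, ← integral_indicator_one measurableSet_ball]
  refine integral_mono (integrable_cutoff μ hε) ((integrable_indicator_iff measurableSet_ball).2
    (integrableOn_const measure_ball_lt_top.ne)) fun x => ?_
  by_cases hx : x ∈ Metric.ball (0 : E) (1 + ε)
  · rw [Set.indicator_of_mem hx, Pi.one_apply]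
    exact max_le zero_le_one (min_le_left _ _)
  · rw [Set.indicator_of_notMem hx, cutoff_eq_zero hε (by simpa using hx)]

/-- By Rademacher's theorem the derivative exists almost everywhere, and convexity bounds it below
by `f x - f (x - z)`. On the support of the cutoff, moving `x` to `0` changes each of the two values
by at most `K (1 + ε)`. -/
theorem mul_integral_cutoff_le {f : E → ℝ} {K : ℝ≥0} (hf : ConvexOn ℝ Set.univ f)
    (hl : LipschitzWith K f) {ε : ℝ} (hε : 0 < ε) (z : E) :
    (f 0 - f (-z) - 2 * K * (1 + ε)) * ∫ x, cutoff ε x ∂μ ≤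
      ∫ x, lineDeriv ℝ f x z * cutoff ε x ∂μ := by
  rw [← integral_const_mul]
  refine integral_mono_ae ((integrable_cutoff μ hε).const_mul _)
    ((integrable_cutoff μ hε).bdd_mul (c := K * ‖z‖)
      (measurable_lineDeriv hl.continuous).aestronglyMeasurable
      (Filter.Eventually.of_forall fun x => norm_lineDeriv_le_of_lipschitz ℝ hl)) ?_
  filter_upwards [hl.ae_lineDifferentiableAt (μ := μ) z] with x hx
  rcases lt_or_ge ‖x‖ (1 + ε) with h | h
  · refine mul_le_mul_of_nonneg_right ?_ (cutoff_nonneg _ _)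
    have h1 := sub_le_lineDeriv hf hx
    have h2 := hl.dist_le_mul x 0
    have h3 := hl.dist_le_mul (x - z) (-z)
    rw [Real.dist_eq, dist_zero_right] at h2
    rw [Real.dist_eq, dist_eq_norm, sub_neg_eq_add, sub_add_cancel] at h3
    have h4 : (K : ℝ) * ‖x‖ ≤ K * (1 + ε) := mul_le_mul_of_nonneg_left h.le K.2
    linarith [neg_abs_le (f x - f 0), le_abs_self (f (x - z) - f (-z))]
  · simp [cutoff_eq_zero hε h]

theorem volumeIoiPow_real_Ico (n : ℕ) {ε : ℝ} (hε : 0 < ε) :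
    (Measure.volumeIoiPow n).real (Set.Ico (⟨1, Set.mem_Ioi.2 one_pos⟩ : Set.Ioi (0 : ℝ))
      ⟨1 + ε, Set.mem_Ioi.2 (by linarith)⟩) = ((1 + ε) ^ (n + 1) - 1) / (n + 1) := by
  rw [← Set.Iio_sdiff_Iio, measureReal_sdiff _ measurableSet_Iio
    (by rw [Measure.volumeIoiPow_apply_Iio]; exact ENNReal.ofReal_ne_top), volumeIoiPow_real_Iio,
    volumeIoiPow_real_Iio]
  · simp [sub_div]
  · exact Set.Iio_subset_Iio (Subtype.mk_le_mk.2 (by linarith))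

variable [Nontrivial E]

/-- The derivative of the cutoff lives on the shell `1 ≤ ‖x‖ < 1 + ε`, up to the null spheres where
the cutoff has kinks. There `f (r • u)` is replaced by `f u` at cost `K ε`; the prefactor is the
radial mass of the shell divided by `ε`, which tends to `1`. -/
theorem integral_lineDeriv_cutoff_le {f : E → ℝ} {K : ℝ≥0} (hl : LipschitzWith K f)
    {ε : ℝ} (hε : 0 < ε) (z : E) :
    ∫ x, lineDeriv ℝ (cutoff ε) x (-z) * f x ∂μ ≤
      ((1 + ε) ^ Module.finrank ℝ E - 1) / (ε * Module.finrank ℝ E) *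
        (∫ u, inner ℝ u.1 z * f u.1 ∂μ.toSphere + ‖z‖ * K * ε * μ.toSphere.real Set.univ) := by
  set n := Module.finrank ℝ E - 1 with hn
  have hn1 : n + 1 = Module.finrank ℝ E := Nat.sub_add_cancel Module.finrank_pos
  set I : Set (Set.Ioi (0 : ℝ)) := Set.Ico ⟨1, Set.mem_Ioi.2 one_pos⟩
      ⟨1 + ε, Set.mem_Ioi.2 (by linarith)⟩ with hI
  set S : Set (Metric.sphere (0 : E) 1 × Set.Ioi (0 : ℝ)) := Set.univ ×ˢ I with hS
  have hSm : MeasurableSet S := MeasurableSet.univ.prod measurableSet_Ico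
  set F : E → ℝ := (norm ⁻¹' Set.Ico (1 : ℝ) (1 + ε)).indicator
    fun x => ε⁻¹ * (inner ℝ x z / ‖x‖) * f x with hF
  have hae : ∀ᵐ x ∂μ, lineDeriv ℝ (cutoff ε) x (-z) * f x = F x := by
    have h1 : ∀ᵐ x ∂μ, x ∉ Metric.sphere (0 : E) 1 := measure_eq_zero_iff_ae_notMem.1
      (Measure.addHaar_sphere μ 0 1)
    have h2 : ∀ᵐ x ∂μ, x ∉ Metric.sphere (0 : E) (1 + ε) := measure_eq_zero_iff_ae_notMem.1
      (Measure.addHaar_sphere μ 0 (1 + ε))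
    filter_upwards [h1, h2] with x hx1 hx2
    rw [mem_sphere_zero_iff_norm] at hx1 hx2
    rcases lt_or_gt_of_ne hx1 with h | h
    · rw [lineDeriv_cutoff_of_norm_lt hε h, zero_mul, hF, Set.indicator_of_notMem]
      exact fun hc => absurd hc.1 (not_le.2 h)
    rcases lt_or_gt_of_ne hx2 with h' | h'
    · rw [lineDeriv_cutoff_shell hε h h', hF, Set.indicator_of_mem]
      exact ⟨h.le, h'⟩
    · rw [lineDeriv_cutoff_of_lt_norm hε h', zero_mul, hF, Set.indicator_of_notMem]
      exact fun hc => absurd hc.2 (not_lt.2 h'.le)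
  have hFp : ∀ p : Metric.sphere (0 : E) 1 × Set.Ioi (0 : ℝ), F (p.2.1 • p.1.1) =
      S.indicator (fun p => ε⁻¹ * (inner ℝ p.1.1 z * f (p.2.1 • p.1.1))) p := by
    rintro ⟨⟨v, hv⟩, ⟨r, hr⟩⟩
    have hr' : (0 : ℝ) < r := hr
    have hv' : ‖v‖ = 1 := by simpa using hv
    have hnorm : ‖r • v‖ = r := by rw [norm_smul, hv', mul_one, Real.norm_of_nonneg hr'.le]
    by_cases h : 1 ≤ r ∧ r < 1 + ε
    · rw [hF, Set.indicator_of_mem (by simpa [hnorm] using h),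
        Set.indicator_of_mem (by simpa [hS, hI] using h), hnorm, real_inner_smul_left]
      field_simp
    · rw [hF, Set.indicator_of_notMem (by simpa [hnorm] using h),
        Set.indicator_of_notMem (by simpa [hS, hI] using h)]
  have hInt : (Measure.volumeIoiPow n).real I = ((1 + ε) ^ Module.finrank ℝ E - 1) /
      Module.finrank ℝ E := by
    rw [hI, volumeIoiPow_real_Ico n hε, ← hn1]
    push_cast
    rfl
  have hIfin : Measure.volumeIoiPow n I ≠ ⊤ := by
    refine ne_top_of_le_ne_top ?_ (measure_mono (Set.Ico_subset_Iio_self))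
    rw [Measure.volumeIoiPow_apply_Iio]
    exact ENNReal.ofReal_ne_top
  have hSfin : (μ.toSphere.prod (Measure.volumeIoiPow n)) S ≠ ⊤ := by
    rw [hS, Measure.prod_prod]
    exact ENNReal.mul_ne_top (measure_ne_top _ _) hIfin
  have hsm : Continuous fun p : Metric.sphere (0 : E) 1 × Set.Ioi (0 : ℝ) => p.2.1 • p.1.1 := by
    fun_prop
  have hinn : Continuous fun u : Metric.sphere (0 : E) 1 => inner ℝ u.1 z := by fun_prop
  have hinnle : ∀ u : Metric.sphere (0 : E) 1, |inner ℝ u.1 z| ≤ ‖z‖ := fun u => by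
    simpa using abs_real_inner_le_norm u.1 z
  have hdiff : ∀ p ∈ S, |f (p.2.1 • p.1.1) - f p.1.1| ≤ K * ε := by
    rintro ⟨u, r⟩ hp
    have h1 : (1 : ℝ) ≤ r.1 := hp.2.1
    have h2 : r.1 < 1 + ε := hp.2.2
    have h3 := hl.dist_le_mul (r.1 • u.1) u.1
    have h4 : r.1 • u.1 - u.1 = (r.1 - 1) • u.1 := by rw [sub_smul, one_smul]
    rw [Real.dist_eq, dist_eq_norm, h4, norm_smul, norm_eq_of_mem_sphere, mul_one,
      Real.norm_of_nonneg (by linarith)] at h3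
    exact h3.trans (mul_le_mul_of_nonneg_left (by linarith) K.2)
  have hfu : ∀ u : Metric.sphere (0 : E) 1, |f u.1| ≤ |f 0| + K := by
    intro u
    have h3 := hl.dist_le_mul u.1 0
    rw [Real.dist_eq, dist_zero_right, norm_eq_of_mem_sphere, mul_one] at h3
    linarith [abs_sub_abs_le_abs_sub (f u.1) (f 0)]
  have hεi : 0 ≤ ε⁻¹ := inv_nonneg.2 hε.le
  have hint1 : IntegrableOn (fun p : Metric.sphere (0 : E) 1 × Set.Ioi (0 : ℝ) =>
      ε⁻¹ * (inner ℝ p.1.1 z * f (p.2.1 • p.1.1))) S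
      (μ.toSphere.prod (Measure.volumeIoiPow n)) := by
    refine Measure.integrableOn_of_bounded (M := ε⁻¹ * (‖z‖ * (|f 0| + K + K * ε))) hSfin
      (continuous_const.mul
        ((hinn.comp continuous_fst).mul (hl.continuous.comp hsm))).aestronglyMeasurable ?_
    filter_upwards [ae_restrict_mem hSm] with p hp
    rw [Real.norm_eq_abs, abs_mul, abs_mul, abs_of_nonneg hεi]
    refine mul_le_mul_of_nonneg_left (mul_le_mul (hinnle _) ?_ (abs_nonneg _) (norm_nonneg _)) hεi
    linarith [hdiff p hp, hfu p.1, abs_sub_abs_le_abs_sub (f (p.2.1 • p.1.1)) (f p.1.1)]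
  -- The factor `1` displays the integrand as a function of the direction times a function of the
  -- radius, as the product formula below requires.
  have hint2 : IntegrableOn (fun p : Metric.sphere (0 : E) 1 × Set.Ioi (0 : ℝ) =>
      ε⁻¹ * (inner ℝ p.1.1 z * f p.1.1 + ‖z‖ * K * ε) * 1) S
      (μ.toSphere.prod (Measure.volumeIoiPow n)) := by
    refine Measure.integrableOn_of_bounded (M := ε⁻¹ * (‖z‖ * (|f 0| + K) + ‖z‖ * K * ε)) hSfin
      (((continuous_const.mul (((hinn.comp continuous_fst).mul (hl.continuous.comp
        (continuous_subtype_val.comp continuous_fst))).add continuous_const)).mul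
          continuous_const).aestronglyMeasurable) ?_
    filter_upwards with p
    rw [mul_one, Real.norm_eq_abs, abs_mul, abs_of_nonneg hεi]
    refine mul_le_mul_of_nonneg_left ((abs_add_le _ _).trans (add_le_add ?_ (abs_of_nonneg ?_).le))
      hεi
    · rw [abs_mul]
      exact mul_le_mul (hinnle _) (hfu _) (abs_nonneg _) (norm_nonneg _)
    · have := K.2
      positivity
  have hintu : Integrable (fun u : Metric.sphere (0 : E) 1 => inner ℝ u.1 z * f u.1) μ.toSphere :=
    (hinn.mul (hl.continuous.comp continuous_subtype_val)).integrable_of_hasCompactSupport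
      (HasCompactSupport.of_compactSpace _)
  calc ∫ x, lineDeriv ℝ (cutoff ε) x (-z) * f x ∂μ = ∫ x, F x ∂μ := integral_congr_ae hae
    _ = ∫ p in S, ε⁻¹ * (inner ℝ p.1.1 z * f (p.2.1 • p.1.1))
          ∂(μ.toSphere.prod (Measure.volumeIoiPow n)) := by
        rw [integral_polar, ← integral_indicator hSm]
        exact integral_congr_ae (Filter.Eventually.of_forall hFp)
    _ ≤ ∫ p in S, ε⁻¹ * (inner ℝ p.1.1 z * f p.1.1 + ‖z‖ * K * ε) * 1
          ∂(μ.toSphere.prod (Measure.volumeIoiPow n)) := by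
        refine setIntegral_mono_on hint1 hint2 hSm fun p hp => ?_
        rw [mul_one]
        refine mul_le_mul_of_nonneg_left ?_ hεi
        have h1 : inner ℝ p.1.1 z * (f (p.2.1 • p.1.1) - f p.1.1) ≤ ‖z‖ * (K * ε) := by
          refine (le_abs_self _).trans ?_
          rw [abs_mul]
          exact mul_le_mul (hinnle _) (hdiff p hp) (abs_nonneg _) (norm_nonneg _)
        linarith
    _ = ((1 + ε) ^ Module.finrank ℝ E - 1) / (ε * Module.finrank ℝ E) *
        (∫ u, inner ℝ u.1 z * f u.1 ∂μ.toSphere + ‖z‖ * K * ε * μ.toSphere.real Set.univ) := by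
        rw [hS, setIntegral_prod_mul (fun u : Metric.sphere (0 : E) 1 =>
          ε⁻¹ * (inner ℝ u.1 z * f u.1 + ‖z‖ * K * ε)) fun _ => (1 : ℝ), setIntegral_univ,
          integral_const_mul, integral_add hintu (integrable_const _), setIntegral_const, hInt,
          integral_const]
        simp only [smul_eq_mul]
        field_simp

/-- Lower bound for the surface integral of `⟨u, z⟩ f u`, for convex Lipschitz `f`. -/
theorem mul_measureReal_ball_le_integral_toSphere {f : E → ℝ} {K : ℝ≥0}
    (hf : ConvexOn ℝ Set.univ f) (hl : LipschitzWith K f) (z : E) :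
    (f 0 - f (-z) - 2 * K) * μ.real (Metric.ball 0 1) ≤
      ∫ u, inner ℝ u.1 z * f u.1 ∂μ.toSphere := by
  set D := Module.finrank ℝ E with hD
  have hDpos : (0 : ℝ) < D := by exact_mod_cast Module.finrank_pos
  set A := ∫ u, inner ℝ u.1 z * f u.1 ∂μ.toSphere with hA
  set V := μ.real (Metric.ball (0 : E) 1) with hV
  have hid : Filter.Tendsto (fun ε : ℝ => ε) (nhdsWithin 0 (Set.Ioi 0)) (nhds 0) :=
    Filter.tendsto_id.mono_left nhdsWithin_le_nhds
  have hm : Filter.Tendsto (fun ε => ∫ x, cutoff ε x ∂μ) (nhdsWithin 0 (Set.Ioi 0)) (nhds V) := by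
    have hup : Filter.Tendsto (fun ε : ℝ => (1 + ε) ^ D * V) (nhdsWithin 0 (Set.Ioi 0))
        (nhds V) := by
      simpa using ((hid.const_add 1).pow D).mul_const V
    refine tendsto_of_tendsto_of_tendsto_of_le_of_le' tendsto_const_nhds hup ?_ ?_
    · filter_upwards [self_mem_nhdsWithin] with ε hε
      exact measureReal_ball_le_integral_cutoff μ hε
    · filter_upwards [self_mem_nhdsWithin] with ε hε
      exact integral_cutoff_le μ hε
  have hslope : Filter.Tendsto (fun ε : ℝ => ((1 + ε) ^ D - 1) / (ε * D))
      (nhdsWithin 0 (Set.Ioi 0)) (nhds 1) := by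
    have h : HasDerivAt (fun ε : ℝ => (1 + ε) ^ D) D 0 := by
      simpa using ((hasDerivAt_id (0 : ℝ)).const_add 1).fun_pow D
    have h2 := (hasDerivAt_iff_tendsto_slope.1 h).mono_left
      (nhdsWithin_mono 0 fun (x : ℝ) (hx : x ∈ Set.Ioi 0) => (ne_of_gt hx : x ≠ 0))
    have h3 := h2.div_const (D : ℝ)
    rw [div_self hDpos.ne'] at h3
    refine h3.congr fun ε => ?_
    simp [slope_def_field, div_div]
  have hleft := ((((hid.const_add 1).const_mul (2 * (K : ℝ))).const_sub (f 0 - f (-z))).mul hm)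
  have hright := hslope.mul (((hid.const_mul (‖z‖ * K)).mul_const
    (μ.toSphere.real Set.univ)).const_add A)
  have := le_of_tendsto_of_tendsto hleft hright ?_
  · simpa using this
  filter_upwards [self_mem_nhdsWithin] with ε hε
  refine (mul_integral_cutoff_le μ hf hl hε z).trans ?_
  -- Integration by parts for Lipschitz functions moves the derivative from `f` to the cutoff.
  rw [hl.integral_lineDeriv_mul_eq (lipschitzWith_cutoff hε) (hasCompactSupport_cutoff hε)]
  exact integral_lineDeriv_cutoff_le μ hl hε z

end Cutoff

/-- The factor `d` is the ratio of the surface measure of the sphere to the volume of the ball. -/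
theorem sub_le_integral_inner_mul {d : ℕ} (hd : 0 < d) {f : Vec d → ℝ} {K : ℝ≥0}
    (hf : ConvexOn ℝ Set.univ f) (hl : LipschitzWith K f) (z : Vec d) :
    f 0 - f (-z) - 2 * K ≤ d * ∫ u, inner ℝ u.1 z * f u.1 ∂uniformSphere d := by
  have := nontrivial_vec hd
  have hd' : (0 : ℝ) < d := by exact_mod_cast hd
  have hV : 0 < (volume : Measure (Vec d)).real (Metric.ball 0 1) :=
    ENNReal.toReal_pos (Metric.measure_ball_pos _ _ one_pos).ne' measure_ball_lt_top.ne
  have h := mul_measureReal_ball_le_integral_toSphere volume hf hl z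
  rw [integral_uniformSphere, mul_inv, mul_assoc, ← mul_assoc (d : ℝ), mul_inv_cancel₀ hd'.ne',
    one_mul, ← div_eq_inv_mul, le_div_iff₀ hV]
  exact h

/-! ### Mirror descent with the Euclidean regularizer -/

section MirrorDescent

variable {d : ℕ} {W : Set (Vec d)}

/-- The prediction of mirror descent with the Euclidean regularizer. -/
noncomputable abbrev proj (W : Set (Vec d)) (θ : Vec d) : Vec d :=
  predict W (fun w => 1 / 2 * ‖w‖ ^ 2) θ

theorem proj_spec (hne : W.Nonempty) (hc : IsCompact W) (θ : Vec d) :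
    proj W θ ∈ W ∧ ∀ w ∈ W, inner ℝ θ w - 1 / 2 * ‖w‖ ^ 2 ≤
      inner ℝ θ (proj W θ) - 1 / 2 * ‖proj W θ‖ ^ 2 := by
  have hcont : Continuous fun w : Vec d => inner ℝ θ w - 1 / 2 * ‖w‖ ^ 2 := by fun_prop
  exact Classical.epsilon_spec (hc.exists_isMaxOn hne hcont.continuousOn)

theorem proj_inner_le (hne : W.Nonempty) (hc : IsCompact W) (hconv : Convex ℝ W) (θ : Vec d)
    {w : Vec d} (hw : w ∈ W) : inner ℝ (θ - proj W θ) (w - proj W θ) ≤ 0 := by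
  obtain ⟨hpW, hmax⟩ := proj_spec hne hc θ
  set p := proj W θ
  set c : ℝ := inner ℝ (θ - p) (w - p) with hcdef
  have key : ∀ s : ℝ, 0 < s → s ≤ 1 → c ≤ s / 2 * ‖w - p‖ ^ 2 := by
    intro s hs hs1
    have h := hmax (p + s • (w - p)) (hconv.add_smul_sub_mem hpW hw ⟨hs.le, hs1⟩)
    rw [inner_add_right, norm_add_sq_real, real_inner_smul_right, real_inner_smul_right, norm_smul,
      mul_pow, Real.norm_eq_abs, sq_abs] at h
    rw [hcdef, inner_sub_left]
    refine le_of_mul_le_mul_left ?_ hs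
    linarith
  by_contra! hpos
  have hn : 0 ≤ ‖w - p‖ ^ 2 := sq_nonneg _
  -- The `+ 1` keeps the quotient meaningful when `w` is the maximizer itself; a step this short
  -- contradicts `key`.
  have h := key (min 1 (c / (‖w - p‖ ^ 2 + 1))) (lt_min one_pos (by positivity)) (min_le_left _ _)
  have h2 : min 1 (c / (‖w - p‖ ^ 2 + 1)) * (‖w - p‖ ^ 2 + 1) ≤ c := by
    rw [← le_div_iff₀ (by positivity)]
    exact min_le_right _ _
  have h3 : 0 < min 1 (c / (‖w - p‖ ^ 2 + 1)) := lt_min one_pos (by positivity)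
  linarith

/-- Adding the variational inequalities at the two points shows that `proj W` is nonexpansive.
Continuity is what makes the iterates measurable. -/
theorem continuous_proj (hne : W.Nonempty) (hc : IsCompact W) (hconv : Convex ℝ W) :
    Continuous (proj W) := by
  refine LipschitzWith.continuous (K := 1) (LipschitzWith.of_dist_le_mul fun θ θ' => ?_)
  rw [NNReal.coe_one, one_mul, dist_eq_norm, dist_eq_norm]
  have h1 := proj_inner_le hne hc hconv θ (proj_spec hne hc θ').1
  have h2 := proj_inner_le hne hc hconv θ' (proj_spec hne hc θ).1
  set p := proj W θ
  set p' := proj W θ'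
  have h3 : inner ℝ (p - p') (p - p') ≤ inner ℝ (θ - θ') (p - p') := by
    simp only [inner_sub_left, inner_sub_right] at *
    linarith
  have h4 := h3.trans (real_inner_le_norm _ _)
  rw [real_inner_self_eq_norm_sq, sq] at h4
  rcases (norm_nonneg (p - p')).eq_or_lt with h | h
  · rw [← h]; exact norm_nonneg _
  · exact le_of_mul_le_mul_right h4 h

/-- The conjugate of the regularizer over `W`. -/
noncomputable def potential (W : Set (Vec d)) (θ : Vec d) : ℝ :=
  inner ℝ θ (proj W θ) - 1 / 2 * ‖proj W θ‖ ^ 2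

/-- This is smoothness of the conjugate: the variational inequality at `θ`, tested at the new
prediction `q`, combined with `‖g + (q - p)‖² ≥ 0`. -/
theorem potential_sub_le (hne : W.Nonempty) (hc : IsCompact W) (hconv : Convex ℝ W) (θ g : Vec d) :
    potential W (θ - g) ≤ potential W θ - inner ℝ g (proj W θ) + 1 / 2 * ‖g‖ ^ 2 := by
  have h1 := proj_inner_le hne hc hconv θ (proj_spec hne hc (θ - g)).1
  rw [potential, potential]
  set p := proj W θ
  set q := proj W (θ - g)
  have h2 : 0 ≤ ‖g + (q - p)‖ ^ 2 := sq_nonneg _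
  rw [← real_inner_self_eq_norm_sq] at *
  rw [← real_inner_self_eq_norm_sq, ← real_inner_self_eq_norm_sq]
  simp only [inner_sub_left, inner_sub_right, inner_add_left, inner_add_right] at *
  have := real_inner_comm p q
  have := real_inner_comm g p
  have := real_inner_comm g q
  linarith

/-- The potential telescopes from a value at most `0`, and its final value is bounded below by
testing the supremum at `wstar`. Here `g` stands for the step with its size included. -/
theorem sum_inner_proj_sub_le (hne : W.Nonempty) (hc : IsCompact W) (hconv : Convex ℝ W) {R : ℝ}
    (hR : ∀ w ∈ W, ‖w‖ ≤ R) {θ g : ℕ → Vec d} (h0 : θ 0 = 0) (T : ℕ)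
    (hstep : ∀ t, θ (t + 1) = θ t - g t) {wstar : Vec d} (hw : wstar ∈ W) :
    ∑ t ∈ Finset.range T, inner ℝ (g t) (proj W (θ t) - wstar) ≤
      R ^ 2 / 2 + 1 / 2 * ∑ t ∈ Finset.range T, ‖g t‖ ^ 2 := by
  have hΦ : ∑ t ∈ Finset.range T, inner ℝ (g t) (proj W (θ t)) ≤
      potential W 0 - potential W (θ T) + 1 / 2 * ∑ t ∈ Finset.range T, ‖g t‖ ^ 2 := by
    induction T with
    | zero => simp [h0]
    | succ T ih =>
      rw [Finset.sum_range_succ, Finset.sum_range_succ, hstep]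
      linarith [potential_sub_le hne hc hconv (θ T) (g T)]
  have hθ : θ T = -∑ t ∈ Finset.range T, g t := by
    clear hΦ
    induction T with
    | zero => simp [h0]
    | succ T ih => rw [hstep, ih, Finset.sum_range_succ]; abel
  have h1 : potential W 0 ≤ 0 := by
    rw [potential, inner_zero_left]
    linarith [sq_nonneg ‖proj W 0‖]
  have h2 : inner ℝ (θ T) wstar - 1 / 2 * ‖wstar‖ ^ 2 ≤ potential W (θ T) :=
    (proj_spec hne hc (θ T)).2 wstar hw
  rw [hθ, inner_neg_left, sum_inner, ← hθ] at h2
  have h3 : ‖wstar‖ ^ 2 ≤ R ^ 2 := pow_le_pow_left₀ (norm_nonneg _) (hR _ hw) 2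
  simp only [inner_sub_right, Finset.sum_sub_distrib]
  linarith

end MirrorDescent

/-! ### Bias and second moment of the gradient estimate -/

section GradientEstimate

variable {d : ℕ} {f : Vec d → ℝ} {K : ℝ≥0} {δ : ℝ}

theorem abs_sub_le_of_sphere (hl : LipschitzWith K f) (hδ : 0 < δ) (w : Vec d) (u : UnitSphere d) :
    |f (w + δ • u.1) - f (w - δ • u.1)| ≤ 2 * δ * K := by
  have h := hl.dist_le_mul (w + δ • u.1) (w - δ • u.1)
  rw [Real.dist_eq, dist_eq_norm, add_sub_sub_cancel, ← two_smul ℝ, smul_smul, norm_smul,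
    norm_eq_of_mem_sphere, mul_one, Real.norm_of_nonneg (by positivity)] at h
  linarith

theorem norm_gradEst_le (hl : LipschitzWith K f) (hδ : 0 < δ) (w : Vec d) (u : UnitSphere d) :
    ‖gradEst f δ w u‖ ≤ d * K := by
  rw [gradEst, norm_smul, norm_eq_of_mem_sphere, mul_one, Real.norm_eq_abs, abs_mul,
    abs_of_nonneg (by positivity)]
  calc _ ≤ (d : ℝ) / (2 * δ) * (2 * δ * K) :=
        mul_le_mul_of_nonneg_left (abs_sub_le_of_sphere hl hδ w u) (by positivity)
    _ = d * K := by field_simp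

theorem convexOn_comp_affine (hf : ConvexOn ℝ Set.univ f) (w : Vec d) (c : ℝ) :
    ConvexOn ℝ Set.univ fun x => f (w + c • x) := by
  refine ⟨convex_univ, fun x _ y _ a b ha hb hab => ?_⟩
  have h := hf.2 (Set.mem_univ (w + c • x)) (Set.mem_univ (w + c • y)) ha hb hab
  have e : a • (w + c • x) + b • (w + c • y) = w + c • (a • x + b • y) := by
    have : a • w + b • w = w := by rw [← add_smul, hab, one_smul]
    rw [smul_add, smul_add, smul_add, smul_comm a c, smul_comm b c, add_add_add_comm, this]
  rwa [e] at h

theorem lipschitzWith_comp_affine (hl : LipschitzWith K f) (w : Vec d) (c : ℝ) :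
    LipschitzWith (K * ‖c‖₊) fun x => f (w + c • x) := by
  refine LipschitzWith.of_dist_le_mul fun x y => (hl.dist_le_mul _ _).trans_eq ?_
  rw [dist_add_left, dist_smul₀, NNReal.coe_mul, coe_nnnorm, mul_assoc]

theorem integrable_of_continuous_sphere (hd : 0 < d) {g : UnitSphere d → ℝ} (hg : Continuous g) :
    Integrable g (uniformSphere d) := by
  have := isProbabilityMeasure_uniformSphere hd
  exact hg.integrable_of_hasCompactSupport (HasCompactSupport.of_compactSpace _)

/-- The gradient estimate is, up to the smoothing error, a subgradient in expectation. -/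
theorem sub_le_integral_inner_gradEst (hd : 0 < d) (hf : ConvexOn ℝ Set.univ f)
    (hl : LipschitzWith K f) (hδ : 0 < δ) (w wstar : Vec d) :
    f w - f wstar - 2 * (K * δ) ≤
      ∫ u, inner ℝ (gradEst f δ w u.1) (w - wstar) ∂uniformSphere d := by
  -- With this `z`, the point `w - δ • z` is `wstar`.
  set z : Vec d := δ⁻¹ • (w - wstar) with hz
  have hδz : δ • z = w - wstar := by rw [hz, smul_smul, mul_inv_cancel₀ hδ.ne', one_smul]
  have h1 := sub_le_integral_inner_mul hd (convexOn_comp_affine hf w δ)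
    (lipschitzWith_comp_affine hl w δ) z
  -- The two-point estimate is the average of two one-point estimates; reversing the signs of both
  -- `δ` and `z` gives the same lower bound for the second.
  have h2 := sub_le_integral_inner_mul hd (convexOn_comp_affine hf w (-δ))
    (lipschitzWith_comp_affine hl w (-δ)) (-z)
  have hfc := hl.continuous
  have e : ∀ u : UnitSphere d, inner ℝ (gradEst f δ w u.1) (w - wstar) =
      d / 2 * (inner ℝ u.1 z * f (w + δ • u.1)) +
        d / 2 * (inner ℝ u.1 (-z) * f (w + (-δ) • u.1)) := by
    intro u
    rw [gradEst, real_inner_smul_left, ← hδz, real_inner_smul_right, inner_neg_right, neg_smul,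
      ← sub_eq_add_neg]
    field_simp
    ring
  simp only [e]
  rw [integral_add, integral_const_mul, integral_const_mul]
  · simp only [smul_zero, add_zero, neg_neg, smul_neg, neg_smul, hδz, NNReal.coe_mul, coe_nnnorm,
      norm_neg, Real.norm_of_nonneg hδ.le, ← sub_eq_add_neg, sub_sub_cancel] at h1 h2 ⊢
    linarith
  · exact integrable_of_continuous_sphere hd (by fun_prop)
  · exact integrable_of_continuous_sphere hd (by fun_prop)

/-- The second moment of the gradient estimate is linear in the dimension. -/
theorem integral_norm_sq_gradEst_le (hd : 0 < d) (hf : ConvexOn ℝ Set.univ f)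
    (hl : LipschitzWith K f) (hδ : 0 < δ) (w : Vec d) :
    ∫ u, ‖gradEst f δ w u.1‖ ^ 2 ∂uniformSphere d ≤ 2 * d * K ^ 2 := by
  have hd' : (0 : ℝ) < d := by exact_mod_cast hd
  have h := integral_sq_sub_neg_le hd (convexOn_comp_affine hf w δ)
    (lipschitzWith_comp_affine hl w δ)
  have e : ∀ u : UnitSphere d, ‖gradEst f δ w u.1‖ ^ 2 =
      ((d : ℝ) / (2 * δ)) ^ 2 * (f (w + δ • u.1) - f (w + δ • (-u.1))) ^ 2 := by
    intro u
    rw [gradEst, norm_smul, norm_eq_of_mem_sphere, mul_one, Real.norm_eq_abs, sq_abs, mul_pow,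
      smul_neg, ← sub_eq_add_neg]
  simp only [e]
  rw [integral_const_mul]
  calc _ ≤ ((d : ℝ) / (2 * δ)) ^ 2 * (8 * (K * ‖δ‖₊ : ℝ≥0) ^ 2 / d) :=
        mul_le_mul_of_nonneg_left h (sq_nonneg _)
    _ = 2 * d * K ^ 2 := by
        rw [NNReal.coe_mul, coe_nnnorm, Real.norm_of_nonneg hδ.le]
        field_simp
        ring

end GradientEstimate

/-! ### Joint measurability -/

section Measurability

variable {d : ℕ} {α : Type*} {mα : MeasurableSpace α} {f : α → Vec d → ℝ} {K : ℝ≥0}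

/-- A function measurable in one variable and continuous in the other is jointly measurable, so a
random loss may be evaluated at a random point. -/
theorem measurable_eval (hf : ∀ w, Measurable fun a => f a w) (hl : ∀ a, LipschitzWith K (f a))
    {x : α → Vec d} (hx : Measurable x) : Measurable fun a => f a (x a) := by
  have h := measurable_uncurry_of_continuous_of_measurable (u := fun w a => f a w)
    (fun a => (hl a).continuous) hf
  exact h.comp (hx.prodMk measurable_id)

theorem measurable_gradEst (hf : ∀ w, Measurable fun a => f a w)
    (hl : ∀ a, LipschitzWith K (f a)) {x : α → Vec d} (hx : Measurable x) {u : α → UnitSphere d}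
    (hu : Measurable u) (δ : ℝ) : Measurable fun a => gradEst (f a) δ (x a) (u a) := by
  have hu' : Measurable fun a => (u a : Vec d) := measurable_subtype_coe.comp hu
  unfold gradEst
  exact (measurable_const.mul ((measurable_eval hf hl (hx.add (hu'.const_smul δ))).sub
    (measurable_eval hf hl (hx.sub (hu'.const_smul δ))))).smul hu'

end Measurability

/-! ### One round: integrating out the direction given the history -/

section Round

variable {d : ℕ} {α Ω : Type*} {mα : MeasurableSpace α} {mΩ : MeasurableSpace Ω} {P : Measure Ω}
  [IsProbabilityMeasure P] {X : Ω → α} {U : Ω → UnitSphere d} {f : α → Vec d → ℝ} {K : ℝ≥0}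
  {w : α → Vec d} {δ : ℝ}

/-- Integration over an independent uniform direction. -/
theorem integral_eq_integral_uniformSphere (hd : 0 < d) (hX : Measurable X) (hU : Measurable U)
    (hind : IndepFun X U P) (hlaw : P.map U = uniformSphere d) {H : α × UnitSphere d → ℝ}
    (hH : Measurable H) {C : ℝ} (hC : ∀ p, |H p| ≤ C) :
    ∫ ω, H (X ω, U ω) ∂P = ∫ ω, ∫ u, H (X ω, u) ∂uniformSphere d ∂P ∧
      Integrable (fun ω => ∫ u, H (X ω, u) ∂uniformSphere d) P := by
  have := isProbabilityMeasure_uniformSphere hd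
  have := Measure.isProbabilityMeasure_map (μ := P) hX.aemeasurable
  have hmap : P.map (fun ω => (X ω, U ω)) = (P.map X).prod (uniformSphere d) := by
    rw [← hlaw]
    exact hind.map_prod_eq_prod_map_map hX.aemeasurable hU.aemeasurable
  have hint : Integrable H ((P.map X).prod (uniformSphere d)) :=
    Integrable.of_bound hH.aestronglyMeasurable C (Filter.Eventually.of_forall hC)
  have hsm : StronglyMeasurable fun a => ∫ u, H (a, u) ∂uniformSphere d :=
    hH.stronglyMeasurable.integral_prod_right'
  constructor
  · rw [← integral_map (hX.prodMk hU).aemeasurable hH.aestronglyMeasurable, hmap,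
      integral_prod _ hint, integral_map hX.aemeasurable hsm.aestronglyMeasurable]
  · exact hint.integral_prod_left.comp_measurable hX

variable (hd : 0 < d) (hX : Measurable X) (hU : Measurable U)
    (hind : IndepFun X U P) (hlaw : P.map U = uniformSphere d)
    (hf : ∀ x, Measurable fun a => f a x) (hconv : ∀ a, ConvexOn ℝ Set.univ (f a))
    (hl : ∀ a, LipschitzWith K (f a)) (hw : Measurable w) (hδ : 0 < δ)

include hd hX hU hind hlaw hf hconv hl hw hδ

theorem expected_norm_sq_gradEst_le :
    Integrable (fun ω => ‖gradEst (f (X ω)) δ (w (X ω)) (U ω)‖ ^ 2) P ∧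
      ∫ ω, ‖gradEst (f (X ω)) δ (w (X ω)) (U ω)‖ ^ 2 ∂P ≤ 2 * d * K ^ 2 := by
  have hm : Measurable fun p : α × UnitSphere d => ‖gradEst (f p.1) δ (w p.1) p.2‖ ^ 2 :=
    ((measurable_gradEst (f := fun p : α × UnitSphere d => f p.1)
      (fun x => (hf x).comp measurable_fst) (fun p => hl p.1) (hw.comp measurable_fst)
      measurable_snd δ).norm).pow_const 2
  -- This bound, quadratic in `d`, serves only for integrability; the linear one appears after
  -- integrating over the direction.
  have hb : ∀ p : α × UnitSphere d, |‖gradEst (f p.1) δ (w p.1) p.2‖ ^ 2| ≤ (d * K) ^ 2 := by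
    intro p
    rw [abs_of_nonneg (sq_nonneg _)]
    exact pow_le_pow_left₀ (norm_nonneg _) (norm_gradEst_le (hl p.1) hδ _ _) 2
  obtain ⟨h1, h2⟩ := integral_eq_integral_uniformSphere hd hX hU hind hlaw hm hb
  refine ⟨Integrable.of_bound (hm.comp (hX.prodMk hU)).aestronglyMeasurable _
    (Filter.Eventually.of_forall fun ω => hb (X ω, U ω)), ?_⟩
  have hpt : ∀ ω, ∫ u, ‖gradEst (f (X ω)) δ (w (X ω)) u.1‖ ^ 2 ∂uniformSphere d ≤
      2 * d * K ^ 2 := fun ω =>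
    integral_norm_sq_gradEst_le hd (hconv (X ω)) (hl (X ω)) hδ (w (X ω))
  have h3 := integral_mono h2 (integrable_const (2 * d * (K : ℝ) ^ 2)) hpt
  rw [integral_const, probReal_univ, one_smul] at h3
  rw [h1]
  exact h3

theorem expected_sub_le {B : ℝ} {wstar : Vec d} (hB : ∀ a, ‖w a - wstar‖ ≤ B) :
    Integrable (fun ω => f (X ω) (w (X ω)) - f (X ω) wstar) P ∧
    Integrable (fun ω => inner ℝ (gradEst (f (X ω)) δ (w (X ω)) (U ω)) (w (X ω) - wstar)) P ∧
      ∫ ω, (f (X ω) (w (X ω)) - f (X ω) wstar) ∂P ≤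
        ∫ ω, inner ℝ (gradEst (f (X ω)) δ (w (X ω)) (U ω)) (w (X ω) - wstar) ∂P +
          2 * (K * δ) := by
  have hm : Measurable fun p : α × UnitSphere d =>
      inner ℝ (gradEst (f p.1) δ (w p.1) p.2) (w p.1 - wstar) :=
    (measurable_gradEst (f := fun p : α × UnitSphere d => f p.1)
      (fun x => (hf x).comp measurable_fst) (fun p => hl p.1) (hw.comp measurable_fst)
      measurable_snd δ).inner ((hw.comp measurable_fst).sub_const wstar)
  have hb : ∀ p : α × UnitSphere d,
      |inner ℝ (gradEst (f p.1) δ (w p.1) p.2) (w p.1 - wstar)| ≤ d * K * B := by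
    intro p
    refine (abs_real_inner_le_norm _ _).trans ?_
    exact mul_le_mul (norm_gradEst_le (hl p.1) hδ _ _) (hB p.1) (norm_nonneg _) (by positivity)
  obtain ⟨h1, h2⟩ := integral_eq_integral_uniformSphere hd hX hU hind hlaw hm hb
  have hreg : Integrable (fun ω => f (X ω) (w (X ω)) - f (X ω) wstar) P := by
    refine Integrable.of_bound (C := K * B) ?_ (Filter.Eventually.of_forall fun ω => ?_)
    · exact (((measurable_eval hf hl hw).sub (hf wstar)).comp hX).aestronglyMeasurable
    · have h := (hl (X ω)).dist_le_mul (w (X ω)) wstar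
      rw [Real.dist_eq, dist_eq_norm] at h
      exact h.trans (mul_le_mul_of_nonneg_left (hB _) K.2)
  refine ⟨hreg, Integrable.of_bound (hm.comp (hX.prodMk hU)).aestronglyMeasurable _
    (Filter.Eventually.of_forall fun ω => hb (X ω, U ω)), ?_⟩
  rw [h1]
  have h3 : ∫ ω, (f (X ω) (w (X ω)) - f (X ω) wstar - 2 * (K * δ)) ∂P ≤
      ∫ ω, ∫ u, inner ℝ (gradEst (f (X ω)) δ (w (X ω)) u.1) (w (X ω) - wstar)
        ∂uniformSphere d ∂P :=
    integral_mono (hreg.sub (integrable_const _)) h2 fun ω =>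
      sub_le_integral_inner_gradEst hd (hconv _) (hl _) hδ _ _
  rw [integral_sub hreg (integrable_const _), integral_const, probReal_univ, one_smul] at h3
  linarith

end Round

end TwoPointBandit

/-! ### Assembly over the rounds -/

open TwoPointBandit

/-- The loss `f t ω` of round `t` may depend on the past (and on extra randomness), through the
`σ`-algebra `ℱ t`; the direction `u t` is uniform on the sphere, independent of `ℱ t`, and known
from round `t + 1` on. Non-random losses are the case where `f t ω` does not depend on `ω`. -/
theorem mainTheorem3 :
    ∃ c : ℝ, 0 < c ∧
      ∀ (d T : ℕ) (_hd : 0 < d) (_hT : 0 < T)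
        (R : ℝ) (_hR : 0 < R) (G : ℝ≥0) (_hG : 0 < G)
        (W : Set (TwoPointBandit.Vec d)) (_hWclosed : IsClosed W) (_hWconvex : Convex ℝ W)
        (_hWball : ∀ w ∈ W, ‖w‖ ≤ R)
        (η : ℝ) (_hη : η = R / ((G : ℝ) * Real.sqrt ((d : ℝ) * (T : ℝ))))
        (δ : ℕ → ℝ) (_hδpos : ∀ t < T, 0 < δ t)
        (_hδ : ∀ t < T, δ t ≤ R * Real.sqrt ((d : ℝ) / (T : ℝ)))
        (Ω : Type*) (mΩ : MeasurableSpace Ω) (P : Measure Ω) (_hP : IsProbabilityMeasure P)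
        (ℱ : Filtration ℕ mΩ)
        (u : ℕ → Ω → TwoPointBandit.UnitSphere d)
        (_hu_meas : ∀ t < T, Measurable[ℱ (t + 1)] (u t))
        (_hu_indep : ∀ t < T, Indep (MeasurableSpace.comap (u t) inferInstance) (ℱ t) P)
        (_hu_law : ∀ t < T, P.map (u t) = TwoPointBandit.uniformSphere d)
        (f : ℕ → Ω → TwoPointBandit.Vec d → ℝ)
        (_hf_meas : ∀ t < T, ∀ w, Measurable[ℱ t] fun ω => f t ω w)
        (_hf_convex : ∀ t < T, ∀ ω, ConvexOn ℝ Set.univ (f t ω))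
        (_hf_lip : ∀ t < T, ∀ ω, LipschitzWith G (f t ω))
        (wstar : TwoPointBandit.Vec d) (_hwstar : wstar ∈ W),
        let regret : Ω → ℝ := fun ω =>
          TwoPointBandit.avgRegret T (fun t => f t ω)
            (TwoPointBandit.iterate W (fun w => 1 / 2 * ‖w‖ ^ 2) η δ
              (fun t => f t ω) (fun t => u t ω)) wstar
        Integrable regret P ∧
          ∫ ω, regret ω ∂P ≤ c * (G : ℝ) * R * Real.sqrt ((d : ℝ) / (T : ℝ)) := by
  -- In units of `G R √(d/T)`: `1/2` from `R² / (2η)`, `1` from the second moments, `2` from the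
  -- smoothing error with `δ t ≤ R √(d/T)`.
  refine ⟨7 / 2, by norm_num, ?_⟩
  intro d T hd hT R hR G hG W hWclosed hWconvex hWball η hη δ hδpos hδ Ω mΩ P hP ℱ u hu_meas
    hu_indep hu_law f hf_meas hf_convex hf_lip wstar hwstar regret
  have hd' : (0 : ℝ) < d := by exact_mod_cast hd
  have hT' : (0 : ℝ) < T := by exact_mod_cast hT
  have hG' : (0 : ℝ) < G := by exact_mod_cast hG
  have hne : W.Nonempty := ⟨wstar, hwstar⟩
  have hc : IsCompact W := Metric.isCompact_of_isClosed_isBounded hWclosed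
    ((Metric.isBounded_closedBall (x := (0 : Vec d)) (r := R)).subset fun w hw =>
      mem_closedBall_zero_iff.2 (hWball w hw))
  set θ : ℕ → Ω → Vec d := fun t ω => theta W (fun w => 1 / 2 * ‖w‖ ^ 2) η δ
    (fun t => f t ω) (fun t => u t ω) t with hθdef
  set w : ℕ → Ω → Vec d := fun t ω => proj W (θ t ω) with hwdef
  set g : ℕ → Ω → Vec d := fun t ω => gradEst (f t ω) (δ t) (w t ω) (u t ω) with hgdef
  have hstep : ∀ t ω, θ (t + 1) ω = θ t ω - η • g t ω := fun _ _ => rfl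
  have hθm : ∀ t ≤ T, Measurable[ℱ t] (θ t) := by
    intro t
    induction t with
    | zero => exact fun _ => measurable_const
    | succ t ih =>
      intro ht
      have hθt : Measurable[ℱ (t + 1)] (θ t) :=
        (ih (by omega)).mono (ℱ.mono (Nat.le_succ t)) le_rfl
      have hwt : Measurable[ℱ (t + 1)] (w t) :=
        (continuous_proj hne hc hWconvex).measurable.comp hθt
      have hgt : Measurable[ℱ (t + 1)] (g t) :=
        measurable_gradEst (mα := ℱ (t + 1))
          (fun x => (hf_meas t (by omega) x).mono (ℱ.mono (Nat.le_succ t)) le_rfl)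
          (hf_lip t (by omega)) hwt (hu_meas t (by omega)) (δ t)
      exact hθt.sub (hgt.const_smul η)
  have hwm : ∀ t < T, Measurable[ℱ t] (w t) := fun t ht =>
    (continuous_proj hne hc hWconvex).measurable.comp (hθm t ht.le)
  -- The history is the identity of `Ω` with target σ-algebra `ℱ t`; this turns independence from `ℱ
  -- t` into independence of two random variables.
  have hX : ∀ t, Measurable[mΩ, ℱ t] (id : Ω → Ω) := fun t => measurable_id'' (ℱ.le t)
  have hind : ∀ t < T, @IndepFun Ω Ω (UnitSphere d) mΩ (ℱ t) _ id (u t) P := by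
    intro t ht
    refine (@IndepFun_iff_Indep Ω Ω (UnitSphere d) mΩ (ℱ t) _ id (u t) P).2 ?_
    rw [MeasurableSpace.comap_id]
    exact (hu_indep t ht).symm
  have hB : ∀ t ω, ‖w t ω - wstar‖ ≤ R + R := fun t ω =>
    (norm_sub_le _ _).trans (add_le_add (hWball _ (proj_spec hne hc _).1) (hWball _ hwstar))
  have hum : ∀ t < T, Measurable (u t) := fun t ht => (hu_meas t ht).mono (ℱ.le _) le_rfl
  have hsq := fun t (ht : t < T) => expected_norm_sq_gradEst_le (mα := ℱ t) hd (hX t) (hum t ht)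
    (hind t ht) (hu_law t ht) (hf_meas t ht) (hf_convex t ht) (hf_lip t ht) (hwm t ht) (hδpos t ht)
  have hreg := fun t (ht : t < T) => expected_sub_le (mα := ℱ t) hd (hX t) (hum t ht)
    (hind t ht) (hu_law t ht) (hf_meas t ht) (hf_convex t ht) (hf_lip t ht) (hwm t ht) (hδpos t ht)
    (hB t)
  simp only [id] at hsq hreg
  -- The losses themselves need not be integrable; only their differences are bounded, so the two
  -- sums are merged before integrating.
  have hregret : regret = fun ω =>
      1 / (T : ℝ) * ∑ t ∈ Finset.range T, (f t ω (w t ω) - f t ω wstar) := by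
    funext ω
    rw [Finset.sum_sub_distrib, mul_sub]
    rfl
  have hint : ∀ t ∈ Finset.range T, Integrable (fun ω => f t ω (w t ω) - f t ω wstar) P :=
    fun t ht => (hreg t (Finset.mem_range.1 ht)).1
  refine ⟨hregret ▸ (integrable_finsetSum _ hint).const_mul _, ?_⟩
  set s := Real.sqrt ((d : ℝ) / T) with hs
  have hs2 : s ^ 2 = d / T := Real.sq_sqrt (by positivity)
  have hspos : 0 < s := Real.sqrt_pos.2 (by positivity)
  have hsT : Real.sqrt ((d : ℝ) * T) = T * s := by
    rw [← Real.sqrt_sq (show (0 : ℝ) ≤ T * s by positivity), mul_pow, hs2]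
    congr 1
    field_simp
  have hη' : η = R / (G * (T * s)) := by rw [hη, hsT]
  have hηpos : 0 < η := by rw [hη']; positivity
  have hinner : ∫ ω, ∑ t ∈ Finset.range T, inner ℝ (g t ω) (w t ω - wstar) ∂P ≤
      R ^ 2 / (2 * η) + η / 2 * (T * (2 * d * G ^ 2)) := by
    have hintg : ∀ t ∈ Finset.range T, Integrable (fun ω => ‖g t ω‖ ^ 2) P :=
      fun t ht => (hsq t (Finset.mem_range.1 ht)).1
    have hpt : ∀ ω, ∑ t ∈ Finset.range T, inner ℝ (g t ω) (w t ω - wstar) ≤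
        R ^ 2 / (2 * η) + η / 2 * ∑ t ∈ Finset.range T, ‖g t ω‖ ^ 2 := by
      intro ω
      have h := sum_inner_proj_sub_le hne hc hWconvex hWball (θ := fun t => θ t ω)
        (g := fun t => η • g t ω) rfl T (fun t => hstep t ω) hwstar
      simp only [real_inner_smul_left, norm_smul, mul_pow, Real.norm_eq_abs, sq_abs,
        ← Finset.mul_sum] at h
      refine le_of_mul_le_mul_left (h.trans_eq ?_) hηpos
      field_simp
    calc _ ≤ ∫ ω, (R ^ 2 / (2 * η) + η / 2 * ∑ t ∈ Finset.range T, ‖g t ω‖ ^ 2) ∂P :=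
          integral_mono (integrable_finsetSum _ fun t ht => (hreg t (Finset.mem_range.1 ht)).2.1)
            ((integrable_const _).add ((integrable_finsetSum _ hintg).const_mul _)) hpt
      _ = R ^ 2 / (2 * η) + η / 2 * ∑ t ∈ Finset.range T, ∫ ω, ‖g t ω‖ ^ 2 ∂P := by
          rw [integral_add (integrable_const _) ((integrable_finsetSum _ hintg).const_mul _),
            integral_const_mul, integral_finsetSum _ hintg]
          simp
      _ ≤ _ := by
          have : ∑ t ∈ Finset.range T, ∫ ω, ‖g t ω‖ ^ 2 ∂P ≤ T * (2 * d * G ^ 2) := by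
            refine (Finset.sum_le_card_nsmul _ _ (2 * d * (G : ℝ) ^ 2) fun t ht =>
              (hsq t (Finset.mem_range.1 ht)).2).trans_eq ?_
            simp
          gcongr
  have hsum : ∑ t ∈ Finset.range T, ∫ ω, (f t ω (w t ω) - f t ω wstar) ∂P ≤
      R ^ 2 / (2 * η) + η / 2 * (T * (2 * d * G ^ 2)) + T * (2 * (G * (R * s))) := by
    have h1 : ∀ t ∈ Finset.range T, ∫ ω, (f t ω (w t ω) - f t ω wstar) ∂P ≤
        ∫ ω, inner ℝ (g t ω) (w t ω - wstar) ∂P + 2 * (G * (R * s)) := by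
      intro t ht
      have h := (hreg t (Finset.mem_range.1 ht)).2.2
      have h2 := mul_le_mul_of_nonneg_left (hδ t (Finset.mem_range.1 ht)) hG'.le
      linarith
    refine (Finset.sum_le_sum h1).trans ?_
    rw [Finset.sum_add_distrib, ← integral_finsetSum _ fun t ht =>
      (hreg t (Finset.mem_range.1 ht)).2.1]
    simp only [Finset.sum_const, Finset.card_range, nsmul_eq_mul]
    linarith
  rw [hregret, integral_const_mul, integral_finsetSum _ hint]
  calc _ ≤ 1 / (T : ℝ) *
        (R ^ 2 / (2 * η) + η / 2 * (T * (2 * d * G ^ 2)) + T * (2 * (G * (R * s)))) :=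
        mul_le_mul_of_nonneg_left hsum (by positivity)
    _ = 7 / 2 * G * R * s := by
        have hdT : (d : ℝ) = s ^ 2 * T := by rw [hs2]; field_simp
        rw [hη', hdT]
        field_simp
        ring
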